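/- Let $G$ be a group with a fixed finite generating set $S$, and regard the Cayley graph $\mathrm{Cay}(G,S)$ as a geodesic metric space with edges of length $1$. For a subset $Y$ of a metric space, $\mathcal N_r(Y)$ denotes the closed $r$-neighbourhood of $Y$. For $Q\ge 1$ and $q\ge 0$, a (improved) $(Q,q)$-quasi-geodesic is a continuous map $\eta\colon[c,d]\to \mathrm{Cay}(G,S)$ such that for all $s,t\in[c,d]$ one has $\frac1Q|s-t|-q\le d(\eta(s),\eta(t))\le Q|s-t|+q$, and the arc length of $\eta$ between the parameters $s\le t$ is at most $k_1\,d(\eta(s),\eta(t))+k_2$, where $k_1=Q(Q+q)$ and $k_2=(2Q(Q+q)+3)(Q+q)$. Given a function $M\colon[1,\infty)\times[0,\infty)\to[0,\infty)$ (a Morse gauge), a geodesic segment $\gamma$ is called $M$-Morse if every $(Q,q)$-quasi-geodesic with endpoints $\gamma(s),\gamma(t)$ is contained in $\mathcal N_{M(Q,q)}(\gamma|_{[s,t]})$, for all $Q\ge1$, $q\ge0$ and all $s\le t$ in the domain of $\gamma$. A subgroup $H\le G$ is stable if there are a Morse gauge $M$ and a radius $r\ge 0$ such that every two elements of $H$ can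 be joined in $\mathrm{Cay}(G,S)$ by an $M$-Morse geodesic contained in $\mathcal N_r(H)$. It is almost malnormal if $H\cap gHg^{-1}$ is finite for every $g\in G\setminus H$. Let $H$ be an almost malnormal stable subgroup of $G$ and let $\delta\ge 0$. Then there is a constant $R=R(G,S,H,\delta)$ with the following property. Let $g_1,g_2\in G$ with $g_1H\ne g_2H$, let $h_1,h_2\in H$, let $\sigma_i$ be a geodesic segment in $\mathrm{Cay}(G,S)$ from $1$ to $h_i$, and let $\gamma_i=g_i\cdot\sigma_i$ be its left translate $(i=1,2)$. Then every subpath of $\gamma_2$ that is contained in $\mathcal N_\delta(\gamma_1)$ has length less than $R$. -/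

import Mathlib

open scoped NNReal

/-! ### The geometric realization of a connected graph -/

namespace SimpleGraph

variable {V : Type*}

/-- `x`, in barycentric coordinates, lies on the closed edge of `Γ` with endpoints `a` and `b`.
The degenerate case `a = b` is allowed; then `x` is the vertex `a`. -/
def OnEdge (Γ : SimpleGraph V) (x : V →₀ ℝ) (a b : V) : Prop :=
  (a = b ∨ Γ.Adj a b) ∧ x ∈ segment ℝ (Finsupp.single a (1 : ℝ)) (Finsupp.single b (1 : ℝ))

/-- The geometric realization of `Γ`: its points are the points of the closed edges, in
barycentric coordinates. -/
structure Realization (Γ : SimpleGraph V) where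
  /-- The barycentric coordinates of the point. -/
  coord : V →₀ ℝ
  exists_onEdge : ∃ a b : V, Γ.OnEdge coord a b

/-- The vertex `v` as a point of the geometric realization. -/
noncomputable def Realization.vertex (Γ : SimpleGraph V) (v : V) : Γ.Realization where
  coord := Finsupp.single v 1
  exists_onEdge := ⟨v, v, Or.inl rfl, left_mem_segment ℝ _ _⟩

/-- The lengths of the direct routes between two points `x`, `y` of the realization: leave `x`
along an edge towards an endpoint `a`, follow a shortest edge path from `a` to an endpoint `a'`
of an edge that contains `y`, and go from there to `y` along that edge; or, if `x` and `y` lie on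
one edge, go from `x` to `y` inside that edge. Every edge has length `1`. -/
def Realization.routeLengths {Γ : SimpleGraph V} (x y : Γ.Realization) : Set ℝ :=
  {r | ∃ a b a' b' : V, Γ.OnEdge x.coord a b ∧ Γ.OnEdge y.coord a' b' ∧
      r = (1 - x.coord a) + (Γ.dist a a' : ℝ) + (1 - y.coord a')} ∪
  {r | ∃ a b : V, Γ.OnEdge x.coord a b ∧ Γ.OnEdge y.coord a b ∧
      r = |x.coord a - y.coord a|}

section Lemmas

variable {Γ : SimpleGraph V}

theorem OnEdge.cases {x : V →₀ ℝ} {a b : V} (h : Γ.OnEdge x a b) :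
    (a = b ∧ x a = 1 ∨ Γ.Adj a b ∧ a ≠ b ∧ x a + x b = 1) ∧ 0 ≤ x a ∧ 0 ≤ x b ∧
      x a ≤ 1 ∧ x b ≤ 1 ∧ ∀ w, w ≠ a → w ≠ b → x w = 0 := by
  classical
  obtain ⟨hab, p, q, hp, hq, hpq, rfl⟩ := h
  have hw : ∀ w, w ≠ a → w ≠ b →
      (p • Finsupp.single a (1 : ℝ) + q • Finsupp.single b (1 : ℝ)) w = 0 := by
    intro w h1 h2
    simp [h1.symm, h2.symm]
  by_cases e : a = b
  · subst e
    have hx : (p • Finsupp.single a (1 : ℝ) + q • Finsupp.single a (1 : ℝ)) a = 1 := by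
      simp [hpq]
    exact ⟨Or.inl ⟨rfl, hx⟩, by rw [hx]; norm_num, by rw [hx]; norm_num, hx.le, hx.le, hw⟩
  · have h1 : (p • Finsupp.single a (1 : ℝ) + q • Finsupp.single b (1 : ℝ)) a = p := by
      simp [Ne.symm e]
    have h2 : (p • Finsupp.single a (1 : ℝ) + q • Finsupp.single b (1 : ℝ)) b = q := by
      simp [e]
    have hadj := hab.resolve_left e
    rw [h1, h2]
    exact ⟨Or.inr ⟨hadj, e, hpq⟩, hp, hq, by linarith, by linarith, hw⟩

theorem OnEdge.symm {x : V →₀ ℝ} {a b : V} (h : Γ.OnEdge x a b) : Γ.OnEdge x b a :=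
  ⟨h.1.imp Eq.symm fun h => h.symm, by rw [segment_symm]; exact h.2⟩

theorem OnEdge.eq_or_eq {x : V →₀ ℝ} {a b p : V} (h : Γ.OnEdge x a b) (hp : x p = 1) :
    p = a ∨ p = b := by
  by_contra! hne
  have := h.cases.2.2.2.2.2 p hne.1 hne.2
  rw [hp] at this
  exact one_ne_zero this

/-- Two edges that contain a common point coincide, or meet in a vertex, which is that point. -/
theorem OnEdge.same_or_vertex {x : V →₀ ℝ} {a b c d : V} (h : Γ.OnEdge x a b)
    (h' : Γ.OnEdge x c d) : (∃ p, x p = 1) ∨ (c = a ∧ d = b) ∨ (c = b ∧ d = a) := by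
  by_cases hp : ∃ p, x p = 1
  · exact Or.inl hp
  push Not at hp
  refine Or.inr ?_
  obtain ⟨h1, -, -, -, -, h2⟩ := h.cases
  obtain ⟨h3, -, -, -, -, h4⟩ := h'.cases
  rcases h1 with ⟨-, h1⟩ | ⟨-, hab, h1⟩
  · exact absurd h1 (hp a)
  rcases h3 with ⟨-, h3⟩ | ⟨-, hcd, h3⟩
  · exact absurd h3 (hp c)
  have ha : x a ≠ 0 := fun h0 => hp b (by linarith)
  have hb : x b ≠ 0 := fun h0 => hp a (by linarith)
  have ha' : a = c ∨ a = d := by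
    by_contra! hne
    exact ha (h4 a hne.1 hne.2)
  have hb' : b = c ∨ b = d := by
    by_contra! hne
    exact hb (h4 b hne.1 hne.2)
  rcases ha' with e | e <;> rcases hb' with e' | e'
  · exact absurd (e.trans e'.symm) hab
  · exact Or.inl ⟨e.symm, e'.symm⟩
  · exact Or.inr ⟨e'.symm, e.symm⟩
  · exact absurd (e.trans e'.symm) hab

theorem OnEdge.dist_le {x : V →₀ ℝ} {a b p : V} (h : Γ.OnEdge x a b) (hp : x p = 1) :
    (Γ.dist a p : ℝ) ≤ 1 - x a := by
  rcases h.eq_or_eq hp with rfl | rfl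
  · simp [hp]
  · rcases h.cases.1 with ⟨rfl, h1⟩ | ⟨hadj, -, h1⟩
    · simp [h1]
    · rw [dist_eq_one_iff_adj.2 hadj]
      push_cast
      linarith

theorem OnEdge.abs_sub_eq {x y : V →₀ ℝ} {a b : V} (h : Γ.OnEdge x a b) (h' : Γ.OnEdge y a b) :
    |x a - y a| = |x b - y b| := by
  rcases h.cases.1 with ⟨rfl, -⟩ | ⟨-, hne, h1⟩
  · rfl
  · rcases h'.cases.1 with ⟨e, -⟩ | ⟨-, -, h2⟩
    · exact absurd e hne
    · rw [show x a - y a = -(x b - y b) by linarith, abs_neg]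

namespace Realization

theorem routeLengths_comm (x y : Γ.Realization) : x.routeLengths y = y.routeLengths x := by
  have key : ∀ x y : Γ.Realization, x.routeLengths y ⊆ y.routeLengths x := by
    rintro x y r (⟨a, b, a', b', h, h', rfl⟩ | ⟨a, b, h, h', rfl⟩)
    · exact Or.inl ⟨a', b', a, b, h', h, by rw [dist_comm]; ring⟩
    · exact Or.inr ⟨a, b, h', h, abs_sub_comm _ _⟩
  exact (key x y).antisymm (key y x)

theorem routeLengths_nonempty (x y : Γ.Realization) : (x.routeLengths y).Nonempty := by
  obtain ⟨a, b, h⟩ := x.exists_onEdge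
  obtain ⟨a', b', h'⟩ := y.exists_onEdge
  exact ⟨_, Or.inl ⟨a, b, a', b', h, h', rfl⟩⟩

theorem nonneg_of_mem {x y : Γ.Realization} {r : ℝ} (hr : r ∈ x.routeLengths y) : 0 ≤ r := by
  rcases hr with ⟨a, b, a', b', h, h', rfl⟩ | ⟨a, b, h, h', rfl⟩
  · have h1 := h.cases.2.2.2.1
    have h2 := h'.cases.2.2.2.1
    have h3 : (0 : ℝ) ≤ Γ.dist a a' := Nat.cast_nonneg _
    linarith
  · exact abs_nonneg _

theorem bddBelow (x y : Γ.Realization) : BddBelow (x.routeLengths y) :=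
  ⟨0, fun _ hr => nonneg_of_mem hr⟩

theorem coord_mem (x : Γ.Realization) (w : V) : 0 ≤ x.coord w ∧ x.coord w ≤ 1 := by
  obtain ⟨a, b, h⟩ := x.exists_onEdge
  obtain ⟨-, h1, h2, h3, h4, h5⟩ := h.cases
  by_cases ha : w = a
  · subst ha; exact ⟨h1, h3⟩
  by_cases hb : w = b
  · subst hb; exact ⟨h2, h4⟩
  rw [h5 w ha hb]
  norm_num

theorem coord_le {x : Γ.Realization} {a b w : V} (h : Γ.OnEdge x.coord a b) (hw : w ≠ a) :
    x.coord w ≤ 1 - x.coord a := by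
  obtain ⟨h0, -, -, h3, -, h5⟩ := h.cases
  by_cases hb : w = b
  · subst hb
    rcases h0 with ⟨e, -⟩ | ⟨-, -, h1⟩
    · exact absurd e.symm hw
    · linarith
  · rw [h5 w hw hb]
    linarith

theorem abs_coord_sub_le (hΓ : Γ.Connected) {x y : Γ.Realization} {r : ℝ}
    (hr : r ∈ x.routeLengths y) (w : V) : |x.coord w - y.coord w| ≤ r := by
  rcases hr with ⟨a, b, a', b', h, h', rfl⟩ | ⟨a, b, h, h', rfl⟩
  · have h1 := h.cases.2.2.2.1
    have h2 := h'.cases.2.2.2.1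
    obtain ⟨hx0, hx1⟩ := x.coord_mem w
    obtain ⟨hy0, hy1⟩ := y.coord_mem w
    by_cases e : a = a'
    · subst e
      rw [dist_self, abs_le]
      push_cast
      by_cases hw : w = a
      · subst hw
        constructor <;> linarith
      · have h3 := coord_le h hw
        have h4 := coord_le h' hw
        constructor <;> linarith
    · have h3 : (1 : ℝ) ≤ Γ.dist a a' := by
        exact_mod_cast hΓ.pos_dist_of_ne e
      rw [abs_le]
      constructor <;> linarith
  · by_cases ha : w = a
    · subst ha; exact le_rfl
    by_cases hb : w = b
    · subst hb; exact (h.abs_sub_eq h').ge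
    rw [h.cases.2.2.2.2.2 w ha hb, h'.cases.2.2.2.2.2 w ha hb]
    simp

theorem triangle_cross_edge (hΓ : Γ.Connected) {x y z : Γ.Realization} {a b a' b' c d : V}
    (h : Γ.OnEdge x.coord a b) (h' : Γ.OnEdge y.coord a' b') (hy : Γ.OnEdge y.coord c d)
    (hz : Γ.OnEdge z.coord c d) :
    ∃ r ∈ x.routeLengths z, r ≤ ((1 - x.coord a) + (Γ.dist a a' : ℝ) + (1 - y.coord a')) +
      |y.coord c - z.coord c| := by
  rcases hy.same_or_vertex h' with ⟨p, hp⟩ | ⟨rfl, rfl⟩ | ⟨rfl, rfl⟩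
  · have h1 := h'.dist_le hp
    have h2 : (Γ.dist a p : ℝ) ≤ Γ.dist a a' + Γ.dist a' p := by
      exact_mod_cast hΓ.dist_triangle
    rcases hy.eq_or_eq hp with rfl | rfl
    · refine ⟨_, Or.inl ⟨a, b, p, d, h, hz, rfl⟩, ?_⟩
      have h3 := le_abs_self (y.coord p - z.coord p)
      linarith
    · refine ⟨_, Or.inl ⟨a, b, p, c, h, hz.symm, rfl⟩, ?_⟩
      rw [hy.abs_sub_eq hz]
      have h3 := le_abs_self (y.coord p - z.coord p)
      linarith
  · refine ⟨_, Or.inl ⟨a, b, _, _, h, hz, rfl⟩, ?_⟩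
    have h3 := le_abs_self (y.coord a' - z.coord a')
    linarith
  · refine ⟨_, Or.inl ⟨a, b, _, _, h, hz.symm, rfl⟩, ?_⟩
    rw [hy.abs_sub_eq hz]
    have h3 := le_abs_self (y.coord a' - z.coord a')
    linarith

theorem dist_le_of_onEdge (hΓ : Γ.Connected) {x : V →₀ ℝ} {a b c d : V} (h : Γ.OnEdge x a b)
    (h' : Γ.OnEdge x c d) : (Γ.dist a c : ℝ) ≤ (1 - x a) + (1 - x c) := by
  rcases h.same_or_vertex h' with ⟨p, hp⟩ | ⟨rfl, rfl⟩ | ⟨rfl, rfl⟩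
  · have h1 := h.dist_le hp
    have h2 := h'.dist_le hp
    have h3 : (Γ.dist a c : ℝ) ≤ Γ.dist a p + Γ.dist p c := by
      exact_mod_cast hΓ.dist_triangle
    rw [dist_comm (u := p)] at h3
    linarith
  · have h1 := h.cases.2.2.2.1
    rw [dist_self]
    push_cast
    linarith
  · rcases h.cases.1 with ⟨rfl, h1⟩ | ⟨hadj, -, h1⟩
    · simp [h1]
    · rw [dist_eq_one_iff_adj.2 hadj]
      push_cast
      linarith

theorem exists_route_triangle (hΓ : Γ.Connected) {x y z : Γ.Realization} {r s : ℝ}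
    (hr : r ∈ x.routeLengths y) (hs : s ∈ y.routeLengths z) :
    ∃ t ∈ x.routeLengths z, t ≤ r + s := by
  rcases hr with ⟨a, b, a', b', h, h', rfl⟩ | ⟨a, b, h, h', rfl⟩ <;>
    rcases hs with ⟨c, d, c', d', k, k', rfl⟩ | ⟨c, d, k, k', rfl⟩
  · refine ⟨_, Or.inl ⟨a, b, c', d', h, k', rfl⟩, ?_⟩
    have h1 := dist_le_of_onEdge hΓ h' k
    have h2 : (Γ.dist a c' : ℝ) ≤ Γ.dist a a' + Γ.dist a' c' := by
      exact_mod_cast hΓ.dist_triangle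
    have h3 : (Γ.dist a' c' : ℝ) ≤ Γ.dist a' c + Γ.dist c c' := by
      exact_mod_cast hΓ.dist_triangle
    linarith
  · exact triangle_cross_edge hΓ h h' k k'
  · obtain ⟨t, ht, hle⟩ := triangle_cross_edge hΓ k' k h' h
    refine ⟨t, by rwa [routeLengths_comm], ?_⟩
    rw [abs_sub_comm, dist_comm] at hle
    linarith
  · rcases h'.same_or_vertex k with ⟨p, hp⟩ | ⟨rfl, rfl⟩ | ⟨rfl, rfl⟩
    · have e1 : ∃ q, Γ.OnEdge x.coord p q ∧ |x.coord a - y.coord a| = |x.coord p - y.coord p| := by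
        rcases h'.eq_or_eq hp with rfl | rfl
        · exact ⟨_, h, rfl⟩
        · exact ⟨_, h.symm, h.abs_sub_eq h'⟩
      have e2 : ∃ q, Γ.OnEdge z.coord p q ∧ |y.coord c - z.coord c| = |y.coord p - z.coord p| := by
        rcases k.eq_or_eq hp with rfl | rfl
        · exact ⟨_, k', rfl⟩
        · exact ⟨_, k'.symm, k.abs_sub_eq k'⟩
      obtain ⟨q, hq, hq'⟩ := e1
      obtain ⟨q', hq2, hq2'⟩ := e2
      refine ⟨_, Or.inl ⟨p, q, p, q', hq, hq2, rfl⟩, ?_⟩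
      rw [hq', hq2', dist_self, hp]
      have h1 := neg_abs_le (x.coord p - 1)
      have h2 := le_abs_self (1 - z.coord p)
      push_cast
      linarith
    · exact ⟨_, Or.inr ⟨_, _, h, k', rfl⟩, abs_sub_le _ _ _⟩
    · refine ⟨_, Or.inr ⟨_, _, h, k'.symm, rfl⟩, ?_⟩
      rw [k.abs_sub_eq k']
      exact abs_sub_le _ _ _

end Realization

end Lemmas

/-- The path metric on the geometric realization of a connected graph, with edges of length `1`:
the distance of two points is the length of a shortest route between them. -/
noncomputable abbrev Realization.metricSpace {Γ : SimpleGraph V} (hΓ : Γ.Connected) :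
    MetricSpace Γ.Realization where
  dist x y := sInf (x.routeLengths y)
  dist_self x := by
    obtain ⟨a, b, h⟩ := x.exists_onEdge
    exact le_antisymm (csInf_le (bddBelow x x) (Or.inr ⟨a, b, h, h, by simp⟩))
      (le_csInf (routeLengths_nonempty x x) fun _ hr => nonneg_of_mem hr)
  dist_comm x y := by
    rw [routeLengths_comm]
  dist_triangle x y z := by
    rw [← sub_le_iff_le_add]
    refine le_csInf (routeLengths_nonempty x y) fun r hr => ?_
    rw [sub_le_comm]
    refine le_csInf (routeLengths_nonempty y z) fun s hs => ?_
    obtain ⟨t, ht, hle⟩ := exists_route_triangle hΓ hr hs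
    have := csInf_le (bddBelow x z) ht
    linarith
  eq_of_dist_eq_zero {x y} hxy := by
    change sInf (x.routeLengths y) = 0 at hxy
    have key : x.coord = y.coord := by
      ext w
      have h1 : |x.coord w - y.coord w| ≤ sInf (x.routeLengths y) :=
        le_csInf (routeLengths_nonempty x y) fun r hr => abs_coord_sub_le hΓ hr w
      rw [hxy] at h1
      exact sub_eq_zero.1 (abs_eq_zero.1 (le_antisymm h1 (abs_nonneg _)))
    cases x
    cases y
    simpa using key

end SimpleGraph

/-! ### The Cayley graph of a group with respect to a finite generating set -/

/-- A finite generating set of the group `G`. -/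
structure FiniteGeneratingSet (G : Type*) [Group G] where
  /-- The underlying finite set. -/
  carrier : Finset G
  closure_eq_top : Subgroup.closure (carrier : Set G) = ⊤

section Cayley

variable {G : Type*} [Group G]

/-- The Cayley graph of a generating set is connected; `u` and `v` are adjacent in it when `u ≠ v`
and `v = u * s` or `u = v * s` for some generator `s`. -/
theorem FiniteGeneratingSet.connected (S : FiniteGeneratingSet G) :
    (SimpleGraph.mulCayley (S.carrier : Set G)).Connected := by
  have key : ∀ g : G, ∀ u : G,
      (SimpleGraph.mulCayley (S.carrier : Set G)).Reachable u (u * g) := by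
    intro g
    have hg : g ∈ Subgroup.closure (S.carrier : Set G) := by
      rw [S.closure_eq_top]; trivial
    induction hg using Subgroup.closure_induction with
    | mem s hs =>
      intro u
      by_cases e : u = u * s
      · rw [← e]
      · exact SimpleGraph.Adj.reachable
          ((SimpleGraph.mulCayley_adj' _ _ _).2 ⟨e, s, hs, Or.inl rfl⟩)
    | one => intro u; rw [mul_one]
    | mul x y _ _ hx hy => intro u; rw [← mul_assoc]; exact (hx u).trans (hy (u * x))
    | inv x _ hx =>
      intro u
      have := hx (u * x⁻¹)
      rw [inv_mul_cancel_right] at this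
      exact this.symm
  have : Nonempty G := ⟨1⟩
  refine ⟨fun u v => ?_⟩
  have := key (u⁻¹ * v) u
  rwa [mul_inv_cancel_left] at this

/-- The Cayley graph of `G` with respect to `S`, as a geodesic metric space: the geometric
realization of the graph on `G` with edges between `g` and `g * s`, for `s ∈ S`, `g * s ≠ g`. -/
def CayleyGraph (S : FiniteGeneratingSet G) : Type _ :=
  (SimpleGraph.mulCayley (S.carrier : Set G)).Realization

namespace CayleyGraph

noncomputable instance (S : FiniteGeneratingSet G) : MetricSpace (CayleyGraph S) :=
  SimpleGraph.Realization.metricSpace S.connected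

/-- The element `g` of `G` as a vertex of the Cayley graph. -/
noncomputable def vertex (S : FiniteGeneratingSet G) (g : G) : CayleyGraph S :=
  SimpleGraph.Realization.vertex _ g

/-- The action of `G` on its Cayley graph by left translations: on vertices it is left
multiplication, and it is affine on edges. -/
noncomputable instance (S : FiniteGeneratingSet G) : MulAction G (CayleyGraph S) where
  smul g x :=
    { coord := Finsupp.mapDomain (g * ·) x.coord
      exists_onEdge := by
        obtain ⟨a, b, hab, p, q, hp, hq, hpq, h⟩ := x.exists_onEdge
        refine ⟨g * a, g * b, ?_, p, q, hp, hq, hpq, ?_⟩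
        · refine hab.imp (fun e => by rw [e]) fun hadj => ?_
          rw [SimpleGraph.mulCayley_adj'] at hadj ⊢
          obtain ⟨hne, s, hs, h⟩ := hadj
          exact ⟨fun e => hne (mul_left_cancel e), s, hs,
            h.imp (fun e => by rw [mul_assoc, e]) fun e => by rw [mul_assoc, ← e]⟩
        · rw [← h, Finsupp.mapDomain_add, Finsupp.mapDomain_smul, Finsupp.mapDomain_smul,
            Finsupp.mapDomain_single, Finsupp.mapDomain_single] }
  one_smul x := by
    cases x with
    | mk c hc =>
      refine (SimpleGraph.Realization.mk.injEq ..).mpr ?_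
      simp only [one_mul]
      exact Finsupp.mapDomain_id
  mul_smul g h x := by
    cases x with
    | mk c hc =>
      refine (SimpleGraph.Realization.mk.injEq ..).mpr ?_
      change _ = Finsupp.mapDomain (g * ·) (Finsupp.mapDomain (h * ·) c)
      rw [← Finsupp.mapDomain_comp]
      congr 1
      funext w
      exact mul_assoc g h w

end CayleyGraph

end Cayley

/-! ### Quasi-geodesics and the Morse property -/

section Metric

variable {X : Type*} [MetricSpace X]

/-- The restriction of `γ` to `[0, L]` is a geodesic segment (of length `L`) from `x` to `y`. -/
def IsGeodesicSegment (γ : ℝ → X) (L : ℝ) (x y : X) : Prop :=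
  0 ≤ L ∧ γ 0 = x ∧ γ L = y ∧
    ∀ s ∈ Set.Icc 0 L, ∀ t ∈ Set.Icc 0 L, dist (γ s) (γ t) = |s - t|

/-- The restriction of `η` to `[a, b]` is an improved `(Q, q)`-quasi-geodesic: a quasi-isometric
embedding that is continuous and whose arc length between two parameters is bounded by
`k₁ * d + k₂`, where `d` is the distance of the corresponding points, `k₁ = Q * (Q + q)` and
`k₂ = (Q * q' + 3) * (Q + q)` with `q' = 2 * (Q + q)`. In a geodesic space every quasi-geodesic is
at bounded distance from an improved one with the same endpoints. -/
def IsImprovedQuasiGeodesic (Q q : ℝ) (η : ℝ → X) (a b : ℝ) : Prop :=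
  a ≤ b ∧ ContinuousOn η (Set.Icc a b) ∧
    (∀ s ∈ Set.Icc a b, ∀ t ∈ Set.Icc a b,
      1 / Q * |s - t| - q ≤ dist (η s) (η t) ∧ dist (η s) (η t) ≤ Q * |s - t| + q) ∧
    ∀ s ∈ Set.Icc a b, ∀ t ∈ Set.Icc a b, s ≤ t →
      eVariationOn η (Set.Icc s t) ≤ ENNReal.ofReal
        (Q * (Q + q) * dist (η s) (η t) + (Q * (2 * (Q + q)) + 3) * (Q + q))

/-- Morse gauges: functions `[1, ∞) × [0, ∞) → [0, ∞)`. -/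
abbrev MorseGauge : Type := Set.Ici (1 : ℝ) → ℝ≥0 → ℝ≥0

/-- The restriction of `γ` to `[a, b]` is `M`-Morse: every (improved) `(Q, q)`-quasi-geodesic with
endpoints `γ s` and `γ t` is contained in the closed `M Q q`-neighbourhood of the part of `γ`
between `s` and `t`. -/
def IsMorse (M : MorseGauge) (γ : ℝ → X) (a b : ℝ) : Prop :=
  ∀ (Q : Set.Ici (1 : ℝ)) (q : ℝ≥0), ∀ s ∈ Set.Icc a b, ∀ t ∈ Set.Icc a b, s ≤ t →
    ∀ (η : ℝ → X) (c d : ℝ), IsImprovedQuasiGeodesic (Q : ℝ) (q : ℝ) η c d →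
      η c = γ s → η d = γ t →
        η '' Set.Icc c d ⊆ Metric.cthickening (M Q q : ℝ) (γ '' Set.Icc s t)

end Metric

/-! ### Stable and almost malnormal subgroups -/

/-- The subgroup `H` of `G` is stable (with respect to the finite generating set `S`): for some
Morse gauge `M` and radius `R`, every two elements of `H` are joined in the Cayley graph by an
`M`-Morse geodesic that is contained in the closed `R`-neighbourhood of `H`. -/
def IsStableSubgroup {G : Type*} [Group G] (S : FiniteGeneratingSet G) (H : Subgroup G) : Prop :=
  ∃ (M : MorseGauge) (R : ℝ≥0), ∀ h ∈ H, ∀ h' ∈ H, ∃ (γ : ℝ → CayleyGraph S) (L : ℝ),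
    IsGeodesicSegment γ L (CayleyGraph.vertex S h) (CayleyGraph.vertex S h') ∧
    IsMorse M γ 0 L ∧
    γ '' Set.Icc 0 L ⊆ Metric.cthickening (R : ℝ) (CayleyGraph.vertex S '' (H : Set G))

/-- `H` is almost malnormal in `G`: the intersection of `H` and `g H g⁻¹` is finite for every
`g` outside `H`. -/
def IsAlmostMalnormal {G : Type*} [Group G] (H : Subgroup G) : Prop :=
  ∀ g : G, g ∉ H → Set.Finite {x : G | x ∈ H ∧ g⁻¹ * x * g ∈ H}

/-!
A geodesic with endpoints in `H` is itself an improved `(1, 0)`-quasi-geodesic, so stability puts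
it in a uniform neighbourhood of `H` (`IsStableSubgroup.exists_dist_lt`). Hence every point of the
subpath of `γ₂` is close to some `a ∈ g₂H` and to some `b ∈ g₁H`, and `f = a⁻¹ * b` lies in a finite
ball of `G` which depends only on `H` and `δ`. Moreover `f ∉ H`, because the two cosets differ.

If two points of the subpath, with nearby elements `a, b` and `a', b'`, give the same `f`, then
`a⁻¹ * a'` lies in `H` and in `f H f⁻¹`. This intersection is finite by almost malnormality, and
only finitely many `f` occur, so the distance of `a` and `a'`, and with it that of the two points,
is bounded by a uniform constant. Points of the subpath spaced further apart than this constant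
therefore give different elements `f` of the finite ball; this bounds their number, and with it the
length of the subpath.
-/

/-! ### The metric of the Cayley graph -/

namespace CayleyGraph

variable {G : Type*} [Group G] (S : FiniteGeneratingSet G)

theorem smul_coord (g : G) (x : CayleyGraph S) :
    (g • x).coord = Finsupp.mapDomain (g * ·) x.coord := rfl

theorem smul_coord_mul (g : G) (x : CayleyGraph S) (a : G) :
    (g • x).coord (g * a) = x.coord a := by
  rw [smul_coord]
  exact Finsupp.mapDomain_apply (mul_right_injective g) _ a

theorem smul_vertex (g h : G) : g • vertex S h = vertex S (g * h) := by
  refine (SimpleGraph.Realization.mk.injEq ..).mpr ?_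
  exact Finsupp.mapDomain_single

theorem adj_mul_left (g : G) {a b : G} (h : (SimpleGraph.mulCayley (S.carrier : Set G)).Adj a b) :
    (SimpleGraph.mulCayley (S.carrier : Set G)).Adj (g * a) (g * b) := by
  rw [SimpleGraph.mulCayley_adj'] at h ⊢
  obtain ⟨hne, s, hs, h⟩ := h
  exact ⟨fun e => hne (mul_left_cancel e), s, hs,
    h.imp (fun e => by rw [mul_assoc, e]) fun e => by rw [mul_assoc, ← e]⟩

theorem graphDist_mul_left_le (g a b : G) :
    (SimpleGraph.mulCayley (S.carrier : Set G)).dist (g * a) (g * b) ≤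
      (SimpleGraph.mulCayley (S.carrier : Set G)).dist a b := by
  obtain ⟨p, hp⟩ := S.connected.exists_walk_length_eq_dist a b
  let φ : SimpleGraph.mulCayley (S.carrier : Set G) →g SimpleGraph.mulCayley (S.carrier : Set G) :=
    ⟨(g * ·), fun h => adj_mul_left S g h⟩
  rw [← hp, ← SimpleGraph.Walk.length_map φ p]
  exact SimpleGraph.dist_le _

theorem graphDist_mul_left (g a b : G) :
    (SimpleGraph.mulCayley (S.carrier : Set G)).dist (g * a) (g * b) =
      (SimpleGraph.mulCayley (S.carrier : Set G)).dist a b := by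
  refine (graphDist_mul_left_le S g a b).antisymm ?_
  simpa using graphDist_mul_left_le S g⁻¹ (g * a) (g * b)

theorem onEdge_smul (g : G) {x : CayleyGraph S} {a b : G}
    (h : (SimpleGraph.mulCayley (S.carrier : Set G)).OnEdge x.coord a b) :
    (SimpleGraph.mulCayley (S.carrier : Set G)).OnEdge (g • x).coord (g * a) (g * b) := by
  obtain ⟨hab, p, q, hp, hq, hpq, h⟩ := h
  refine ⟨hab.imp (fun e => by rw [e]) (adj_mul_left S g), p, q, hp, hq, hpq, ?_⟩
  rw [smul_coord, ← h, Finsupp.mapDomain_add, Finsupp.mapDomain_smul, Finsupp.mapDomain_smul,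
    Finsupp.mapDomain_single, Finsupp.mapDomain_single]

theorem routeLengths_subset_smul (g : G) (x y : CayleyGraph S) :
    SimpleGraph.Realization.routeLengths x y ⊆
      SimpleGraph.Realization.routeLengths (g • x) (g • y) := by
  rintro r (⟨a, b, a', b', h, h', rfl⟩ | ⟨a, b, h, h', rfl⟩)
  · refine Or.inl ⟨g * a, g * b, g * a', g * b', onEdge_smul S g h, onEdge_smul S g h', ?_⟩
    rw [smul_coord_mul, smul_coord_mul, graphDist_mul_left]
  · refine Or.inr ⟨g * a, g * b, onEdge_smul S g h, onEdge_smul S g h', ?_⟩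
    rw [smul_coord_mul, smul_coord_mul]

instance : IsIsometricSMul G (CayleyGraph S) := by
  refine ⟨fun g => Isometry.of_dist_eq fun x y => ?_⟩
  change sInf (SimpleGraph.Realization.routeLengths (g • x) (g • y)) =
    sInf (SimpleGraph.Realization.routeLengths x y)
  congr 1
  refine Set.Subset.antisymm ?_ (routeLengths_subset_smul S g x y)
  simpa using routeLengths_subset_smul S g⁻¹ (g • x) (g • y)

theorem graphDist_le_dist_vertex (a b : G) :
    ((SimpleGraph.mulCayley (S.carrier : Set G)).dist a b : ℝ) ≤
      dist (vertex S a) (vertex S b) := by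
  refine le_csInf (SimpleGraph.Realization.routeLengths_nonempty _ _) ?_
  have e : ∀ v : G, (vertex S v).coord v = 1 := fun v => Finsupp.single_eq_same
  rintro r (⟨c, d, c', d', h, h', rfl⟩ | ⟨c, d, h, h', rfl⟩)
  · have h1 := h.dist_le (e a)
    have h2 := h'.dist_le (e b)
    have h3 : ((SimpleGraph.mulCayley (S.carrier : Set G)).dist a b : ℝ) ≤
        (SimpleGraph.mulCayley (S.carrier : Set G)).dist a c +
        (SimpleGraph.mulCayley (S.carrier : Set G)).dist c b := by
      exact_mod_cast S.connected.dist_triangle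
    have h4 : ((SimpleGraph.mulCayley (S.carrier : Set G)).dist c b : ℝ) ≤
        (SimpleGraph.mulCayley (S.carrier : Set G)).dist c c' +
        (SimpleGraph.mulCayley (S.carrier : Set G)).dist c' b := by
      exact_mod_cast S.connected.dist_triangle
    rw [SimpleGraph.dist_comm (u := c) (v := a)] at *
    linarith
  · by_cases hab : a = b
    · subst hab
      simp
    · have key : (c = a ∨ d = a) ∧ (c = b ∨ d = b) :=
        ⟨(h.eq_or_eq (e a)).imp Eq.symm Eq.symm, (h'.eq_or_eq (e b)).imp Eq.symm Eq.symm⟩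
      have h0 : (vertex S b).coord a = 0 := Finsupp.single_eq_of_ne hab
      have h0' : (vertex S a).coord b = 0 := Finsupp.single_eq_of_ne (Ne.symm hab)
      have hadj : (SimpleGraph.mulCayley (S.carrier : Set G)).Adj a b := by
        rcases key with ⟨rfl | rfl, rfl | rfl⟩
        · exact absurd rfl hab
        · exact h.1.resolve_left hab
        · exact (h.1.resolve_left (Ne.symm hab)).symm
        · exact absurd rfl hab
      rw [SimpleGraph.dist_eq_one_iff_adj.2 hadj]
      rcases key.1 with rfl | rfl
      · simp [e, h0]
      · rw [h.abs_sub_eq h']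
        simp [e, h0]

open scoped Pointwise in
theorem finite_graphDist_ball (n : ℕ) :
    {g : G | (SimpleGraph.mulCayley (S.carrier : Set G)).dist 1 g ≤ n}.Finite := by
  classical
  have step : ∀ (a b : G) (p : (SimpleGraph.mulCayley (S.carrier : Set G)).Walk a b),
      a⁻¹ * b ∈ (insert 1 (S.carrier ∪ S.carrier⁻¹)) ^ p.length := by
    intro a b p
    induction p with
    | nil => simp
    | @cons u v w h p ih =>
      rw [SimpleGraph.Walk.length_cons, pow_succ']
      refine Finset.mem_mul.2 ⟨u⁻¹ * v, ?_, _, ih, by group⟩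
      rw [SimpleGraph.mulCayley_adj'] at h
      obtain ⟨-, s, hs, h | h⟩ := h
      · simp [← h, Finset.mem_coe.1 hs]
      · have : u⁻¹ * v = s⁻¹ := by rw [h]; group
        simp [this, Finset.mem_coe.1 hs]
  refine ((insert 1 (S.carrier ∪ S.carrier⁻¹)) ^ n).finite_toSet.subset fun g hg => ?_
  obtain ⟨p, hp⟩ := S.connected.exists_walk_length_eq_dist 1 g
  have h1 := step 1 g p
  rw [inv_one, one_mul] at h1
  have h2 : p.length ≤ n := hp.trans_le hg
  exact Finset.pow_subset_pow_right (Finset.mem_insert_self _ _) h2 h1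

/-- Balls in `G` are finite; this is where the finiteness of `S` is used. -/
theorem finite_dist_vertex_le (r : ℝ) :
    {g : G | dist (vertex S 1) (vertex S g) ≤ r}.Finite := by
  refine (finite_graphDist_ball S ⌊r⌋₊).subset fun g hg => ?_
  exact Nat.le_floor ((graphDist_le_dist_vertex S 1 g).trans hg)

theorem dist_vertex_eq (a b : G) :
    dist (vertex S a) (vertex S b) = dist (vertex S 1) (vertex S (a⁻¹ * b)) := by
  rw [← dist_smul a (vertex S 1), smul_vertex, smul_vertex, mul_one, mul_inv_cancel_left]

end CayleyGraph

/-! ### Geodesics with endpoints in a stable subgroup -/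

theorem IsGeodesicSegment.length_eq {X : Type*} [MetricSpace X] {γ : ℝ → X} {L : ℝ} {x y : X}
    (h : IsGeodesicSegment γ L x y) : L = dist x y := by
  obtain ⟨hL, h0, h1, hd⟩ := h
  rw [← h0, ← h1, hd 0 ⟨le_rfl, hL⟩ L ⟨hL, le_rfl⟩, zero_sub, abs_neg, abs_of_nonneg hL]

theorem IsGeodesicSegment.isImprovedQuasiGeodesic {X : Type*} [MetricSpace X] {γ : ℝ → X} {L : ℝ}
    {x y : X} (h : IsGeodesicSegment γ L x y) : IsImprovedQuasiGeodesic 1 0 γ 0 L := by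
  obtain ⟨hL, -, -, hd⟩ := h
  have hlip : LipschitzOnWith 1 γ (Set.Icc 0 L) :=
    LipschitzOnWith.of_dist_le_mul fun s hs t ht => by
      rw [hd s hs t ht, Real.dist_eq, NNReal.coe_one, one_mul]
  refine ⟨hL, hlip.continuousOn, fun s hs t ht => ?_, fun s hs t ht hst => ?_⟩
  · rw [hd s hs t ht]
    constructor <;> simp
  · have hsub : Set.Icc s t ⊆ Set.Icc 0 L := Set.Icc_subset_Icc hs.1 ht.2
    have h1 : eVariationOn γ (Set.Icc s t) ≤ ENNReal.ofReal (t - s) := by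
      have h2 := (hlip.mono hsub).comp_eVariationOn_le (g := id) (s := Set.Icc s t)
        (fun _ h => h)
      have h3 := (monotone_id.monotoneOn (Set.Icc s t)).eVariationOn_eq
        (Set.left_mem_Icc.2 hst) (Set.right_mem_Icc.2 hst)
      rw [Set.inter_self] at h3
      simpa using h2.trans (mul_le_mul_right h3.le _)
    refine h1.trans (ENNReal.ofReal_le_ofReal ?_)
    rw [hd s hs t ht, abs_sub_comm, abs_of_nonneg (sub_nonneg.2 hst)]
    linarith

/-- Every geodesic from `1` to an element of a stable subgroup, not only the Morse ones provided by
the definition, stays in a uniform neighbourhood of the subgroup. -/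
theorem IsStableSubgroup.exists_dist_lt {G : Type*} [Group G] {S : FiniteGeneratingSet G}
    {H : Subgroup G} (hH : IsStableSubgroup S H) :
    ∃ D : ℝ, 0 < D ∧ ∀ h ∈ H, ∀ (σ : ℝ → CayleyGraph S) (L : ℝ),
      IsGeodesicSegment σ L (CayleyGraph.vertex S 1) (CayleyGraph.vertex S h) →
      ∀ u ∈ Set.Icc 0 L, ∃ k ∈ H, dist (σ u) (CayleyGraph.vertex S k) < D := by
  obtain ⟨M, r, hM⟩ := hH
  let m : ℝ≥0 := M ⟨1, Set.self_mem_Ici⟩ 0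
  refine ⟨(m + 1) + (r + 1), by positivity, fun h hh σ L hσ u hu => ?_⟩
  obtain ⟨α, L', hα, hmorse, hnear⟩ := hM 1 H.one_mem h hh
  have hL : L = L' := hσ.length_eq.trans hα.length_eq.symm
  subst hL
  have h1 := hmorse ⟨1, Set.self_mem_Ici⟩ 0 0 ⟨le_rfl, hσ.1⟩ L ⟨hσ.1, le_rfl⟩ hσ.1 σ 0 L
    hσ.isImprovedQuasiGeodesic (hσ.2.1.trans hα.2.1.symm) (hσ.2.2.1.trans hα.2.2.1.symm)
    ⟨u, hu, rfl⟩
  -- Closed neighbourhoods are defined by an infimum; the open ones, of radius larger by `1`,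
  -- provide actual points.
  have h2 := Metric.cthickening_subset_thickening' (δ₂ := (m : ℝ) + 1) (by positivity)
    (by change (m : ℝ) < m + 1; linarith) _ h1
  obtain ⟨_, ⟨v, hv, rfl⟩, hv'⟩ := Metric.mem_thickening_iff.1 h2
  have h3 := Metric.cthickening_subset_thickening' (δ₂ := (r : ℝ) + 1) (by positivity)
    (by linarith) _ (hnear ⟨v, hv, rfl⟩)
  obtain ⟨_, ⟨k, hk, rfl⟩, hk'⟩ := Metric.mem_thickening_iff.1 h3
  exact ⟨k, hk, (dist_triangle _ _ _).trans_lt (add_lt_add hv' hk')⟩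

/-! ### Fellow-travelling of geodesics in different cosets -/

/-- Almost malnormality, uniformly over the elements of a finite set outside `H`. -/
theorem IsAlmostMalnormal.exists_dist_le {G : Type*} [Group G] (S : FiniteGeneratingSet G)
    {H : Subgroup G} (hH : IsAlmostMalnormal H) {B : Set G} (hB : B.Finite) :
    ∃ K : ℝ, ∀ f ∈ B, f ∉ H → ∀ x ∈ H, f⁻¹ * x * f ∈ H →
      dist (CayleyGraph.vertex S 1) (CayleyGraph.vertex S x) ≤ K := by
  have hfin : (⋃ f ∈ B \ H, {x : G | x ∈ H ∧ f⁻¹ * x * f ∈ H}).Finite :=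
    (hB.subset Set.sdiff_subset).biUnion fun f hf => hH f hf.2
  obtain ⟨K, hK⟩ := (hfin.image fun x =>
    dist (CayleyGraph.vertex S 1) (CayleyGraph.vertex S x)).bddAbove
  exact ⟨K, fun f hf hfH x hx hx' =>
    hK ⟨x, Set.mem_biUnion (show f ∈ B \ H from ⟨hf, hfH⟩) ⟨hx, hx'⟩, rfl⟩⟩

theorem mainTheorem6 {G : Type*} [Group G] (S : FiniteGeneratingSet G) (H : Subgroup G)
    (hstable : IsStableSubgroup S H) (hmal : IsAlmostMalnormal H) (δ : ℝ) (hδ : 0 ≤ δ) :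
    ∃ R : ℝ, ∀ g₁ g₂ : G, (QuotientGroup.mk g₁ : G ⧸ H) ≠ QuotientGroup.mk g₂ →
      ∀ h₁ ∈ H, ∀ h₂ ∈ H, ∀ (σ₁ σ₂ : ℝ → CayleyGraph S) (L₁ L₂ : ℝ),
        IsGeodesicSegment σ₁ L₁ (CayleyGraph.vertex S 1) (CayleyGraph.vertex S h₁) →
        IsGeodesicSegment σ₂ L₂ (CayleyGraph.vertex S 1) (CayleyGraph.vertex S h₂) →
        ∀ s t : ℝ, 0 ≤ s → s ≤ t → t ≤ L₂ →
          (fun u => g₂ • σ₂ u) '' Set.Icc s t ⊆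
            Metric.cthickening δ ((fun u => g₁ • σ₁ u) '' Set.Icc 0 L₁) →
          t - s < R := by
  obtain ⟨D, hD, hnear⟩ := hstable.exists_dist_lt
  have hB := CayleyGraph.finite_dist_vertex_le S (D + ((δ + 1) + D))
  obtain ⟨K, hK⟩ := hmal.exists_dist_le S hB
  set B := {g : G | dist (CayleyGraph.vertex S 1) (CayleyGraph.vertex S g) ≤ D + ((δ + 1) + D)}
  -- Points of the subpath that are `w` apart give different elements of `B`.
  let w : ℝ := D + max K 0 + D
  have hw : 0 < w := by positivity
  refine ⟨hB.toFinset.card * w, fun g₁ g₂ hg h₁ hh₁ h₂ hh₂ σ₁ σ₂ L₁ L₂ hσ₁ hσ₂ s t hs hst ht hsub =>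
    ?_⟩
  by_contra! hlong
  have hex : ∀ u ∈ Set.Icc s t, ∃ k ∈ H, ∃ k' ∈ H,
      dist (g₂ • σ₂ u) (CayleyGraph.vertex S (g₂ * k)) < D ∧
      dist (g₂ • σ₂ u) (CayleyGraph.vertex S (g₁ * k')) < (δ + 1) + D := by
    intro u hu
    obtain ⟨k, hk, hk'⟩ := hnear h₂ hh₂ σ₂ L₂ hσ₂ u ⟨hs.trans hu.1, hu.2.trans ht⟩
    have h1 := Metric.cthickening_subset_thickening' (δ₂ := δ + 1) (by linarith) (by linarith) _
      (hsub ⟨u, hu, rfl⟩)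
    obtain ⟨_, ⟨v, hv, rfl⟩, hv'⟩ := Metric.mem_thickening_iff.1 h1
    obtain ⟨l, hl, hl'⟩ := hnear h₁ hh₁ σ₁ L₁ hσ₁ v hv
    refine ⟨k, hk, l, hl, ?_, ?_⟩
    · rwa [← CayleyGraph.smul_vertex, dist_smul]
    · rw [← dist_smul g₁, CayleyGraph.smul_vertex] at hl'
      exact (dist_triangle _ _ _).trans_lt (add_lt_add hv' hl')
  choose! k hk k' hk' hd hd' using hex
  let f : ℝ → G := fun u => (g₂ * k u)⁻¹ * (g₁ * k' u)
  have hfB : ∀ u ∈ Set.Icc s t, f u ∈ B := by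
    intro u hu
    change dist _ _ ≤ _
    rw [← CayleyGraph.dist_vertex_eq]
    exact (dist_triangle_left _ _ (g₂ • σ₂ u)).trans (add_le_add (hd u hu).le (hd' u hu).le)
  have hfH : ∀ u ∈ Set.Icc s t, f u ∉ H := by
    intro u hu hf
    refine hg (QuotientGroup.eq.2 ?_)
    have h1 := H.mul_mem (H.mul_mem (hk u hu) hf) (H.inv_mem (hk' u hu))
    have e : k u * f u * (k' u)⁻¹ = (g₁⁻¹ * g₂)⁻¹ := by simp only [f]; group
    rw [e] at h1
    exact inv_mem_iff.1 h1
  have hclose : ∀ u ∈ Set.Icc s t, ∀ v ∈ Set.Icc s t, f u = f v → |u - v| < w := by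
    intro u hu v hv huv
    have h1 : (k u)⁻¹ * k v ∈ H := H.mul_mem (H.inv_mem (hk u hu)) (hk v hv)
    have h2 : (f u)⁻¹ * ((k u)⁻¹ * k v) * f u ∈ H := by
      have e : (f u)⁻¹ * ((k u)⁻¹ * k v) * f u = (k' u)⁻¹ * k' v := by
        nth_rewrite 2 [huv]
        simp only [f]
        group
      rw [e]
      exact H.mul_mem (H.inv_mem (hk' u hu)) (hk' v hv)
    have h3 := hK (f u) (hfB u hu) (hfH u hu) _ h1 h2
    rw [← CayleyGraph.dist_vertex_eq, ← dist_smul g₂, CayleyGraph.smul_vertex,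
      CayleyGraph.smul_vertex] at h3
    have h4 := dist_triangle4 (g₂ • σ₂ u) (CayleyGraph.vertex S (g₂ * k u))
      (CayleyGraph.vertex S (g₂ * k v)) (g₂ • σ₂ v)
    rw [dist_comm (CayleyGraph.vertex S (g₂ * k v)) (g₂ • σ₂ v), dist_smul g₂ (σ₂ u),
      hσ₂.2.2.2 u ⟨hs.trans hu.1, hu.2.trans ht⟩ v ⟨hs.trans hv.1, hv.2.trans ht⟩] at h4
    have h5 := hd u hu
    have h6 := hd v hv
    have h7 := le_max_left K 0
    simp only [w]
    linarith
  have hmem : ∀ i ∈ Finset.range (hB.toFinset.card + 1), s + i * w ∈ Set.Icc s t := by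
    intro i hi
    have h1 : (i : ℝ) ≤ hB.toFinset.card := by
      exact_mod_cast Nat.lt_succ_iff.1 (Finset.mem_range.1 hi)
    have h2 := mul_le_mul_of_nonneg_right h1 hw.le
    have h3 : 0 ≤ (i : ℝ) * w := by positivity
    constructor <;> linarith
  obtain ⟨i, hi, j, hj, hij, he⟩ := Finset.exists_ne_map_eq_of_card_lt_of_maps_to
    (s := Finset.range (hB.toFinset.card + 1)) (t := hB.toFinset) (by simp)
    (f := fun i : ℕ => f (s + i * w)) fun i hi => hB.mem_toFinset.2 (hfB _ (hmem i hi))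
  have h1 := hclose _ (hmem i hi) _ (hmem j hj) he
  have h2 : (1 : ℝ) ≤ |(i : ℝ) - j| := by
    have : (1 : ℤ) ≤ |(i : ℤ) - j| := Int.one_le_abs (by omega)
    exact_mod_cast this
  rw [show s + i * w - (s + j * w) = (i - j) * w by ring, abs_mul, abs_of_pos hw] at h1
  nlinarith
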